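/- Conventions. Let $n\ge 2$. An analytic curve in $\mathbb{R}^n$ is a non-constant continuous map $\gamma=(x_1,\dots,x_n)\colon[a,b]\to\mathbb{R}^n$, $a<b$, each of whose coordinate functions $x_i$ is real analytic on $(a,b)$; its image $\gamma([a,b])$ is also called the curve. A non-empty compact set $E\subset\mathbb{R}^n$ is self-affine if $E=\bigcup_{i=1}^{\ell}f_i(E)$ for finitely many invertible affine maps $f_i\colon\mathbb{R}^n\to\mathbb{R}^n$ that are strictly contractive, i.e. $|f_i(x)-f_i(y)|<|x-y|$ for all $x\ne y$ (Euclidean norm). A self-affine set is non-trivial if it is not a singleton. Put $\eta(t)=(t,t^2,\dots,t^n)$ for $t\in\mathbb{R}$. Theorem. Let $\gamma\colon[a,b]\to\mathbb{R}^n$ be an analytic curve whose image is not contained in any hyperplane of $\mathbb{R}^n$ (a set $\{x:\langle v,x\rangle=r\}$ with $v\neq0$). Then $\gamma([a,b])$ contains a non-trivial self-affine set if and only if there are real numbers $c<d$ and an invertible affine map $f\colon\mathbb{R}^n\to\mathbb{R}^n$ such that $\gamma([a,b])=f(\eta([c,d]))$. Moreover, for all real $c<d$ the arc $\eta([c,d])$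 is itself a non-trivial self-affine set. -/

import Mathlib

/-- A map `f` of `ℝⁿ` is strictly contractive if `|f x - f y| < |x - y|` for all distinct points
`x`, `y` (Euclidean norm). -/
def IsStrictlyContractive {n : ℕ}
    (f : EuclideanSpace ℝ (Fin n) → EuclideanSpace ℝ (Fin n)) : Prop :=
  ∀ x y, x ≠ y → dist (f x) (f y) < dist x y

/-- A self-affine set: a non-empty compact set `E` with `E = ⋃ i, f i (E)` for a finite family of
strictly contractive invertible affine maps `f i` of `ℝⁿ`. -/
def IsSelfAffine {n : ℕ} (E : Set (EuclideanSpace ℝ (Fin n))) : Prop :=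
  E.Nonempty ∧ IsCompact E ∧
    ∃ (l : ℕ) (f : Fin l → (EuclideanSpace ℝ (Fin n) ≃ᵃ[ℝ] EuclideanSpace ℝ (Fin n))),
      (∀ i, IsStrictlyContractive (f i)) ∧ E = ⋃ i, f i '' E

/-- A non-trivial self-affine set: a self-affine set that is not a singleton. -/
def IsNontrivialSelfAffine {n : ℕ} (E : Set (EuclideanSpace ℝ (Fin n))) : Prop :=
  IsSelfAffine E ∧ ¬ ∃ x, E = {x}

/-- `γ : [a, b] → ℝⁿ` is an analytic curve: `a < b`, `γ` is continuous and non-constant on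
`[a, b]`, and every coordinate function is real analytic on `(a, b)`. The values of `γ` outside
`[a, b]` play no role. -/
structure IsAnalyticCurve {n : ℕ} (a b : ℝ) (γ : ℝ → EuclideanSpace ℝ (Fin n)) : Prop where
  lt : a < b
  continuousOn : ContinuousOn γ (Set.Icc a b)
  nonconstant : ∃ s ∈ Set.Icc a b, ∃ t ∈ Set.Icc a b, γ s ≠ γ t
  analytic : ∀ i, AnalyticOnNhd ℝ (fun t => γ t i) (Set.Ioo a b)

/-- A hyperplane of `ℝⁿ`: a set `{x | ⟨v, x⟩ = r}` with `v ≠ 0`. -/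
def IsAffineHyperplane {n : ℕ} (H : Set (EuclideanSpace ℝ (Fin n))) : Prop :=
  ∃ (v : EuclideanSpace ℝ (Fin n)) (r : ℝ), v ≠ 0 ∧ H = {x | inner ℝ v x = r}

/-- The moment curve `η t = (t, t ^ 2, …, t ^ n)`. -/
def momentCurve (n : ℕ) (t : ℝ) : EuclideanSpace ℝ (Fin n) :=
  WithLp.toLp 2 fun i => t ^ ((i : ℕ) + 1)

/-!
An arc of `η` is self-affine because `η (α t + β)` is an affine function of `η t` whose linear part
is of order `α` (`norm_momentLinear_le`): subdividing the arc into many equal pieces writes any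
affine image of it as a union of small affine copies of itself
(`isSelfAffine_image_momentCurve`).

Conversely, let `E` be a non-trivial self-affine set contained in the curve `γ`. Small affine copies
of `E` lie away from the singular values of `γ`, so some contraction `g` maps `E` into the regular
part of the curve. Several branches of `γ` may pass through the fixed point of `g`, but only
finitely many, and a power `G` of `g` preserves one of them: `G (γ t) = γ (φ t)` near a parameter
`s` fixed by `φ` (`exists_invariant_germ`). The transpose of the linear part of `G` has `λ = φ' s`
as an eigenvalue, with an eigenvector `m` not vanishing on the tangent (`exists_eigenfunctional`).
Hence `u = m (γ - γ s)` is a local parameter in which `φ` is multiplication by `λ`, and the Taylor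
coefficients of `γ` in `u` are eigenvectors for the distinct eigenvalues `λ ^ k`. Only finitely many
of them are non-zero, so that `γ = γ s + ∑ u ^ k • w k`, with `k` in a finite set `D` and linearly
independent `w k`; by the identity theorem this holds on the whole of `[a, b]`
(`IsAnalyticCurve.exists_polynomial`).

It remains to see that no exponent is missing (`Icc_subset_of_affine_maps_polynomial`). Each of
the generating maps of `E` carries infinitely many points of the polynomial curve into the curve,
so it acts on the curve as a polynomial change of parameter `P`. If `N` is the largest element of
`D`, then `P ^ N` is a combination of `1` and the monomials with exponents in `D`; by degree `P` is
affine, and if `P` does not fix `0` then all exponents from `1` to `N` occur in `P ^ N`. Not every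
generating map fixes `γ s`, since otherwise `E` would be a singleton. So `D = {1, …, N}`, and `N = n`
because the `w k` form a basis.
-/

open Set Filter Topology

/-! ### Contractions -/

/-- A strictly contractive affine map has a contraction ratio below `1`, because its linear part
attains its norm on the unit sphere. -/
lemma IsStrictlyContractive.exists_contractingWith {n : ℕ}
    {f : EuclideanSpace ℝ (Fin n) ≃ᵃ[ℝ] EuclideanSpace ℝ (Fin n)}
    (hf : IsStrictlyContractive f) : ∃ K, ContractingWith K f := by
  rcases subsingleton_or_nontrivial (EuclideanSpace ℝ (Fin n)) with h | h
  · exact ⟨0, one_pos, LipschitzWith.of_dist_le_mul fun x y => by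
      rw [Subsingleton.elim x y, dist_self, dist_self, mul_zero]⟩
  set L := LinearMap.toContinuousLinearMap f.linear.toLinearMap
  have hdist : ∀ x y, dist (f x) (f y) = ‖L (x - y)‖ := fun x y => by
    rw [dist_eq_norm]
    congr 1
    exact (f.toAffineMap.linearMap_vsub x y).symm
  have hlt : ∀ v, v ≠ 0 → ‖L v‖ < ‖v‖ := fun v hv => by
    have := hf v 0 hv
    rwa [hdist, dist_eq_norm, sub_zero] at this
  obtain ⟨v, hv, hmax⟩ := (isCompact_sphere (0 : EuclideanSpace ℝ (Fin n)) 1).exists_isMaxOn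
    (NormedSpace.sphere_nonempty.2 zero_le_one) L.continuous.norm.continuousOn
  have hv1 : ‖v‖ = 1 := by simpa using hv
  refine ⟨‖L v‖₊, ?_, LipschitzWith.of_dist_le_mul fun x y => ?_⟩
  · have := hlt v (by rintro rfl; simp at hv1)
    rw [hv1] at this
    exact_mod_cast this
  · rw [hdist, dist_eq_norm]
    refine (L.le_opNorm _).trans (mul_le_mul_of_nonneg_right ?_ (norm_nonneg _))
    exact ContinuousLinearMap.opNorm_le_of_unit_norm (norm_nonneg _) fun x hx =>
      hmax (by simpa using hx)

/-- A finite family of strict contractions has a common contraction ratio. -/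
lemma exists_common_contractingWith {n l : ℕ}
    {f : Fin l → (EuclideanSpace ℝ (Fin n) ≃ᵃ[ℝ] EuclideanSpace ℝ (Fin n))}
    (hf : ∀ i, IsStrictlyContractive (f i)) : ∃ K, K < 1 ∧ ∀ i, LipschitzWith K (f i) := by
  choose K hK using fun i => (hf i).exists_contractingWith
  exact ⟨Finset.univ.sup K, (Finset.sup_lt_iff one_pos).2 fun i _ => (hK i).1,
    fun i => (hK i).2.weaken (Finset.le_sup (Finset.mem_univ i))⟩

/-- A contraction mapping a non-empty closed set into itself has a fixed point there, which
attracts all orbits. -/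
lemma ContractingWith.exists_fixedPoint_mem {α : Type*} [MetricSpace α] [CompleteSpace α]
    {K : NNReal} {g : α → α} (hg : ContractingWith K g) {E : Set α} (hE : IsClosed E)
    (hne : E.Nonempty) (hmap : MapsTo g E E) :
    ∃ z ∈ E, g z = z ∧ ∀ x, Tendsto (fun k => g^[k] x) atTop (𝓝 z) := by
  obtain ⟨e, he⟩ := hne
  have : Nonempty α := ⟨e⟩
  exact ⟨_, hE.mem_of_tendsto (hg.tendsto_iterate_fixedPoint e)
    (Eventually.of_forall fun k => hmap.iterate k he), hg.fixedPoint_isFixedPt,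
    hg.tendsto_iterate_fixedPoint⟩

/-- A set invariant under an injective contraction is infinite as soon as it contains two
points. -/
lemma ContractingWith.infinite_of_mapsTo {α : Type*} [MetricSpace α]
    {K : NNReal} {g : α → α} (hg : ContractingWith K g) (hinj : Function.Injective g) {E : Set α}
    (hmap : MapsTo g E E) {z e : α} (hz : g z = z) (he : e ∈ E) (hez : e ≠ z) : E.Infinite := by
  refine Set.infinite_of_injective_forall_mem (f := fun k : ℕ => g^[k] e) ?_
    fun k => hmap.iterate k he
  have hpos : ∀ k, g^[k] e ≠ z := fun k h => hez <| hinj.iterate k <| by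
    rw [h, Function.iterate_fixed hz]
  have hanti : StrictAnti fun k : ℕ => dist (g^[k] e) z := by
    refine strictAnti_nat_of_succ_lt fun k => ?_
    have hd := hg.2.dist_le_mul (g^[k] e) z
    rw [hz, ← Function.iterate_succ_apply' g] at hd
    refine hd.trans_lt (mul_lt_of_lt_one_left (dist_pos.2 (hpos k)) ?_)
    exact_mod_cast hg.1
  exact fun i j hij => hanti.injective (congrArg (dist · z) hij)

/-- Every point of a self-affine set lies in arbitrarily small affine copies of the set. -/
lemma exists_small_copy {n l : ℕ} {E : Set (EuclideanSpace ℝ (Fin n))}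
    {f : Fin l → (EuclideanSpace ℝ (Fin n) ≃ᵃ[ℝ] EuclideanSpace ℝ (Fin n))}
    (hE : IsCompact E) (hEf : E = ⋃ i, f i '' E) {K : NNReal} (hK : K < 1)
    (hf : ∀ i, LipschitzWith K (f i)) {x : EuclideanSpace ℝ (Fin n)} (hx : x ∈ E) {U : Set _}
    (hU : U ∈ 𝓝 x) :
    ∃ g : EuclideanSpace ℝ (Fin n) ≃ᵃ[ℝ] EuclideanSpace ℝ (Fin n),
      ContractingWith K g ∧ MapsTo g E E ∧ MapsTo g E U := by
  have hmaps : ∀ i, MapsTo (f i) E E := fun i y hy => by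
    rw [hEf]; exact mem_iUnion.2 ⟨i, mem_image_of_mem _ hy⟩
  have key : ∀ m : ℕ, ∀ x ∈ E, ∃ g : EuclideanSpace ℝ (Fin n) ≃ᵃ[ℝ] EuclideanSpace ℝ (Fin n),
      LipschitzWith (K ^ (m + 1)) g ∧ MapsTo g E E ∧ x ∈ g '' E := by
    intro m
    induction m with
    | zero =>
      intro x hx
      rw [hEf] at hx
      obtain ⟨i, hi⟩ := mem_iUnion.1 hx
      exact ⟨f i, by simpa using hf i, hmaps i, hi⟩
    | succ m ih =>
      intro x hx
      rw [hEf] at hx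
      obtain ⟨i, y, hy, rfl⟩ := mem_iUnion.1 hx
      obtain ⟨g, hg, hgE, w, hw, rfl⟩ := ih y hy
      refine ⟨g.trans (f i), ?_, ?_, w, hw, rfl⟩
      · rw [pow_succ' K (m + 1), AffineEquiv.coe_trans]
        exact (hf i).comp hg
      · rw [AffineEquiv.coe_trans]
        exact (hmaps i).comp hgE
  obtain ⟨ε, hε, hεU⟩ := Metric.mem_nhds_iff.1 hU
  obtain ⟨C, hC⟩ := hE.isBounded.exists_norm_le
  have hlim : Tendsto (fun m : ℕ => (K : ℝ) ^ (m + 1) * (2 * C)) atTop (𝓝 0) := by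
    have := ((tendsto_pow_atTop_nhds_zero_of_lt_one K.2 (by exact_mod_cast hK)).comp
      (tendsto_add_atTop_nat 1)).mul_const (2 * C)
    simpa using this
  obtain ⟨m, hm⟩ := (hlim.eventually_lt_const hε).exists
  obtain ⟨g, hg, hgE, w, hw, hwx⟩ := key m x hx
  refine ⟨g, ⟨hK, hg.weaken (pow_le_of_le_one zero_le hK.le (Nat.succ_ne_zero m))⟩, hgE,
    fun y hy => hεU ?_⟩
  rw [Metric.mem_ball, ← hwx]
  refine (hg.dist_le_mul y w).trans_lt (lt_of_le_of_lt ?_ hm)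
  push_cast
  gcongr
  calc dist y w ≤ ‖y‖ + ‖w‖ := dist_le_norm_add_norm y w
    _ ≤ 2 * C := by linarith [hC y hy, hC w hw]

/-! ### Germs of analytic curves -/

lemma AnalyticAt.exists_local_inverse {h : ℝ → ℝ} {τ : ℝ} (hh : AnalyticAt ℝ h τ)
    (hd : deriv h τ ≠ 0) :
    ∃ T : ℝ → ℝ, AnalyticAt ℝ T (h τ) ∧ T (h τ) = τ ∧ (∀ᶠ t in 𝓝 τ, T (h t) = t) ∧
      ∀ᶠ u in 𝓝 (h τ), h (T u) = u := by
  refine ⟨_, hh.analyticAt_localInverse hd, ?_, ?_, ?_⟩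
  · exact HasStrictFDerivAt.localInverse_apply_image _
  · exact HasStrictFDerivAt.eventually_left_inverse _
  · exact HasStrictFDerivAt.eventually_right_inverse _

/-- If two analytic curves meet along a sequence of parameters converging to `s` and `τ`, the
first germ factors through the second one, provided that the latter is regular: a coordinate
function of `γ` which is a local parameter at `τ` determines the change of parameter `φ`. -/
lemma exists_analytic_reparam {W α : Type*} [NormedAddCommGroup W] [NormedSpace ℝ W]
    {F : Filter α} [F.NeBot] {γ δ : ℝ → W} {s τ : ℝ} (hδ : AnalyticAt ℝ δ s)
    (hγ : AnalyticAt ℝ γ τ) (hγ' : deriv γ τ ≠ 0) {p q : α → ℝ} (hp : Tendsto p F (𝓝[≠] s))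
    (hq : Tendsto q F (𝓝 τ)) (h : ∀ᶠ x in F, δ (p x) = γ (q x)) :
    ∃ φ : ℝ → ℝ, AnalyticAt ℝ φ s ∧ φ s = τ ∧ ∀ᶠ t in 𝓝 s, δ t = γ (φ t) := by
  obtain ⟨m, hm⟩ := SeparatingDual.exists_ne_zero (R := ℝ) hγ'
  have hp' : Tendsto p F (𝓝 s) := hp.mono_right nhdsWithin_le_nhds
  have hst : δ s = γ τ := tendsto_nhds_unique_of_eventuallyEq
    (hδ.continuousAt.tendsto.comp hp') (hγ.continuousAt.tendsto.comp hq) h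
  have hm1 : AnalyticAt ℝ (fun t => m (γ t)) τ := m.analyticAt _ |>.comp hγ
  have hm2 : AnalyticAt ℝ (fun t => m (δ t)) s := m.analyticAt _ |>.comp hδ
  have hm3 : deriv (fun t => m (γ t)) τ ≠ 0 := by
    have := (m.hasFDerivAt.comp_hasDerivAt τ hγ.differentiableAt.hasDerivAt).deriv
    exact fun h0 => hm (this.symm.trans h0)
  obtain ⟨T, hT, hTτ, hl, -⟩ := hm1.exists_local_inverse hm3
  have hφ : AnalyticAt ℝ (fun t => T (m (δ t))) s := by
    refine AnalyticAt.fun_comp (g := T) ?_ hm2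
    rwa [hst]
  have hφs : T (m (δ s)) = τ := by rw [hst, hTτ]
  refine ⟨fun t => T (m (δ t)), hφ, hφs, ?_⟩
  refine (hδ.frequently_eq_iff_eventually_eq (g := fun t => γ (T (m (δ t)))) ?_).1 ?_
  · refine AnalyticAt.fun_comp (g := γ) ?_ hφ
    rwa [hφs]
  · refine hp.frequently (Eventually.frequently ?_)
    filter_upwards [h, hq.eventually hl] with x hx hx'
    rw [hx, hx']

/-- If the change of parameter `φ` fixes `s` and multiplies an analytic function by `λ = φ' s`,
where `0 < |λ| < 1`, then the order `m` of that function at `s` satisfies `λ ^ m = λ`. So `m = 1`,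
unless the function is zero. -/
lemma eventually_eq_zero_of_semiconj {u φ : ℝ → ℝ} {s : ℝ} (hu : AnalyticAt ℝ u s)
    (hu' : deriv u s = 0) (hφ : AnalyticAt ℝ φ s) (hφs : φ s = s) (h0 : deriv φ s ≠ 0)
    (h1 : |deriv φ s| < 1) (h : ∀ᶠ t in 𝓝 s, u (φ t) = deriv φ s * u t) :
    ∀ᶠ t in 𝓝 s, u t = 0 := by
  by_contra hne
  obtain ⟨m, w, hw, hws, hm⟩ := hu.exists_eventuallyEq_pow_smul_nonzero_iff.2 hne
  have hφc : Tendsto φ (𝓝 s) (𝓝 s) := by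
    have := hφ.continuousAt.tendsto
    rwa [hφs] at this
  have hlim : deriv φ s ^ m * w s = deriv φ s * w s := by
    have hsl := hφ.differentiableAt.hasDerivAt.tendsto_slope
    have hle : 𝓝[≠] s ≤ 𝓝 s := nhdsWithin_le_nhds
    refine tendsto_nhds_unique_of_eventuallyEq
      ((hsl.pow m).mul (hw.continuousAt.tendsto.comp (hφc.mono_left hle)))
      ((hw.continuousAt.tendsto.mono_left hle).const_mul (deriv φ s)) ?_
    filter_upwards [h.filter_mono hle, hm.filter_mono hle, (hφc.eventually hm).filter_mono hle,
      self_mem_nhdsWithin] with t h1 h2 h3 hts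
    have hts' : t - s ≠ 0 := sub_ne_zero.2 hts
    rw [h3, h2, smul_eq_mul, smul_eq_mul] at h1
    simp only [slope_def_field, hφs, Function.comp, div_pow]
    field_simp
    linarith
  have hpow := mul_right_cancel₀ hws hlim
  -- the order of vanishing `m` is neither `0` nor `1`, and `λ ^ m = λ` has no other solution
  rcases m with _ | _ | m
  · rw [pow_zero] at hpow
    rw [← hpow] at h1
    simp at h1
  · have hd : HasDerivAt (fun t => (t - s) ^ (0 + 1) • w t) (w s) s := by
      have := ((hasDerivAt_id s).sub_const s).mul hw.differentiableAt.hasDerivAt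
      simp only [id, sub_self, zero_mul, add_zero, one_mul] at this
      simpa [zero_add, pow_one, Pi.mul_def] using this
    have := (hd.congr_of_eventuallyEq hm).deriv
    exact hws (this.symm.trans hu')
  · have h2 : deriv φ s ^ (m + 1) = 1 := by
      rw [pow_succ] at hpow
      exact mul_right_cancel₀ h0 (hpow.trans (one_mul _).symm)
    have h3 : |deriv φ s| ^ (m + 1) = 1 := by rw [← abs_pow, h2, abs_one]
    exact (pow_lt_one₀ (abs_nonneg _) h1 (Nat.succ_ne_zero m)).ne h3

/-- If the affine map with linear part `A` and fixed point `γ s` acts on the germ of `γ` at `s`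
as the change of parameter `φ`, then the multiplier `λ` of `φ` is an eigenvalue of the transpose
of `A`, with an eigenvector that is a local parameter on the curve. -/
lemma exists_eigenfunctional {W : Type*} [NormedAddCommGroup W] [NormedSpace ℝ W]
    [FiniteDimensional ℝ W] {γ : ℝ → W} {φ : ℝ → ℝ} {s : ℝ} {A : W →L[ℝ] W}
    (hγ : AnalyticAt ℝ γ s) (hγ' : deriv γ s ≠ 0) (hφ : AnalyticAt ℝ φ s) (hφs : φ s = s)
    (hA : ∀ v, v ≠ 0 → A v ≠ 0) (hA' : ∀ v, v ≠ 0 → ‖A v‖ < ‖v‖)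
    (h : ∀ᶠ t in 𝓝 s, γ (φ t) - γ s = A (γ t - γ s))
    (hnd : ∀ m : W →L[ℝ] ℝ, (∀ᶠ t in 𝓝 s, m (γ t) = m (γ s)) → m = 0) :
    deriv φ s ≠ 0 ∧ |deriv φ s| < 1 ∧
      ∃ m : W →L[ℝ] ℝ, m (deriv γ s) ≠ 0 ∧ ∀ w, m (A w) = deriv φ s * m w := by
  set v := deriv γ s
  set c := deriv φ s
  have hγd : HasDerivAt γ v s := hγ.differentiableAt.hasDerivAt
  have hAv : A v = c • v := by
    have h1 : HasDerivAt (fun t => A (γ t - γ s)) (A v) s :=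
      A.hasFDerivAt.comp_hasDerivAt s (hγd.sub_const _)
    have h2 : HasDerivAt (fun t => γ (φ t) - γ s) (c • v) s := by
      refine HasDerivAt.sub_const _ (HasDerivAt.scomp (h := φ) s ?_ hφ.differentiableAt.hasDerivAt)
      rwa [hφs]
    exact (h1.congr_of_eventuallyEq h).unique h2
  have hc0 : c ≠ 0 := fun h0 => hA v hγ' (by rw [hAv, h0, zero_smul])
  have hc1 : |c| < 1 := by
    have := hA' v hγ'
    rw [hAv, norm_smul, Real.norm_eq_abs] at this
    exact (mul_lt_iff_lt_one_left (norm_pos_iff.2 hγ')).1 this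
  refine ⟨hc0, hc1, ?_⟩
  -- `T = Aᵀ - λ` takes values in the functionals vanishing on the tangent vector `v`
  set T : Module.Dual ℝ W →ₗ[ℝ] Module.Dual ℝ W :=
    A.toLinearMap.dualMap - c • LinearMap.id with hT
  have hTapp : ∀ m w, T m w = m (A w) - c * m w := fun m w => by simp [hT]
  have hnsurj : ¬ Function.Surjective T := fun hs => by
    obtain ⟨m, hm⟩ := SeparatingDual.exists_ne_zero (R := ℝ) hγ'
    obtain ⟨m', hm'⟩ := hs m.toLinearMap
    apply hm
    have := LinearMap.congr_fun hm' v
    rw [hTapp, hAv, map_smul, smul_eq_mul, sub_self] at this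
    exact this.symm
  have hninj : ¬ Function.Injective T := fun hi => hnsurj (LinearMap.injective_iff_surjective.1 hi)
  rw [← LinearMap.ker_eq_bot, Submodule.eq_bot_iff] at hninj
  push Not at hninj
  obtain ⟨m, hm, hm0⟩ := hninj
  have hmA : ∀ w, m (A w) = c * m w := fun w => by
    have := LinearMap.congr_fun (LinearMap.mem_ker.1 hm) w
    rw [hTapp, LinearMap.zero_apply] at this
    linarith
  set m' : W →L[ℝ] ℝ := LinearMap.toContinuousLinearMap m with hm'
  have hmm : ∀ w, m' w = m w := fun _ => rfl
  refine ⟨m', fun hmv => hm0 ?_, fun w => by rw [hmm, hmm, hmA]⟩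
  -- `m` vanishing on `v` would be constant on the curve
  have hu : AnalyticAt ℝ (fun t => m' (γ t - γ s)) s :=
    (m'.analyticAt _).comp (hγ.sub analyticAt_const)
  have hz := eventually_eq_zero_of_semiconj hu
    ((m'.hasFDerivAt.comp_hasDerivAt s (hγd.sub_const (γ s))).deriv.trans hmv) hφ hφs
    hc0 hc1 (h.mono fun t ht => by rw [ht, hmm, hmA, hmm])
  have := hnd m' (hz.mono fun t ht => by rwa [map_sub, sub_eq_zero] at ht)
  ext w
  rw [← hmm, this]
  rfl

/-- An analytic germ on which a linear map acts as a scaling of the parameter is polynomial: its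
Taylor coefficients are eigenvectors for distinct eigenvalues. -/
lemma exists_polynomial_of_scaling {W : Type*} [NormedAddCommGroup W] [NormedSpace ℝ W]
    [FiniteDimensional ℝ W] {Γ : ℝ → W} {c : ℝ} {A : W →L[ℝ] W} (hΓ : AnalyticAt ℝ Γ 0)
    (hc0 : c ≠ 0) (hc1 : |c| < 1)
    (h : ∀ᶠ x in 𝓝 0, Γ (c * x) - Γ 0 = A (Γ x - Γ 0)) :
    ∃ (D : Finset ℕ) (w : ℕ → W), 0 ∉ D ∧ LinearIndependent ℝ (fun k : D => w k) ∧
      ∀ᶠ x in 𝓝 0, Γ x = Γ 0 + ∑ k ∈ D, x ^ k • w k := by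
  obtain ⟨p, hp⟩ : AnalyticAt ℝ (fun x => Γ x - Γ 0) 0 := hΓ.sub analyticAt_const
  rw [hasFPowerSeriesAt_iff] at hp
  simp only [zero_add] at hp
  have hcx : Tendsto (fun x : ℝ => c * x) (𝓝 0) (𝓝 0) := by
    have : Tendsto (fun x : ℝ => c * x) (𝓝 0) (𝓝 (c * 0)) :=
      (continuous_const.mul continuous_id).tendsto 0
    rwa [mul_zero] at this
  have hcoef : ∀ k, A (p.coeff k) = c ^ k • p.coeff k := by
    let q : FormalMultilinearSeries ℝ ℝ W := fun k =>
      ContinuousMultilinearMap.mkPiRing ℝ (Fin k) (A (p.coeff k) - c ^ k • p.coeff k)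
    have hqc : ∀ k, q.coeff k = A (p.coeff k) - c ^ k • p.coeff k := fun k => by
      rw [FormalMultilinearSeries.coeff, ContinuousMultilinearMap.mkPiRing_apply]
      simp
    have hq : HasFPowerSeriesAt 0 q 0 := by
      rw [hasFPowerSeriesAt_iff]
      filter_upwards [hp, hcx.eventually hp, h] with x h1 h2 h3
      have h4 := (h1.mapL A).sub h2
      rw [h3, sub_self] at h4
      simp only [Pi.zero_apply]
      convert h4 using 2 with k
      rw [hqc, map_smul, smul_sub, smul_smul, mul_pow, mul_comm]
    intro k
    have : q.coeff k = 0 := by rw [hq.eq_zero]; rfl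
    rwa [hqc, sub_eq_zero] at this
  have hinj : Function.Injective fun k : {k // p.coeff k ≠ 0} => c ^ (k : ℕ) := by
    intro i j hij
    have : |c| ^ (i : ℕ) = |c| ^ (j : ℕ) := by
      rw [← abs_pow, ← abs_pow]; exact congrArg _ hij
    exact Subtype.ext (pow_right_injective₀ (abs_pos.2 hc0) hc1.ne this)
  have hli : LinearIndependent ℝ fun k : {k // p.coeff k ≠ 0} => p.coeff k :=
    Module.End.eigenvectors_linearIndependent' A.toLinearMap _ hinj _ fun k =>
      ⟨Module.End.mem_eigenspace_iff.2 (hcoef k), k.2⟩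
  have hfin : {k | p.coeff k ≠ 0}.Finite := Set.finite_coe_iff.1 hli.finite
  refine ⟨hfin.toFinset, p.coeff, ?_, ?_, ?_⟩
  · have h0 := hp.self_of_nhds
    have h1 := hasSum_single (f := fun k => (0 : ℝ) ^ k • p.coeff k) 0 fun k hk => by
      simp [zero_pow hk]
    have := h0.unique h1
    simpa using this.symm
  · exact hli.comp (fun k : hfin.toFinset => ⟨k, hfin.mem_toFinset.1 k.2⟩) fun i j hij =>
      Subtype.ext (Subtype.mk.inj hij)
  · filter_upwards [hp] with x hx
    have := hx.unique (hasSum_sum_of_ne_finset_zero (s := hfin.toFinset) fun k hk => by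
      have : p.coeff k = 0 := by simpa using hk
      rw [this, smul_zero])
    rw [← this, add_sub_cancel]

/-! ### Linearization along an invariant germ -/

/-- In the local parameter given by an eigenfunctional `m`, an analytic germ invariant under an
affine contraction is polynomial. -/
lemma exists_local_polynomial {W : Type*} [NormedAddCommGroup W] [NormedSpace ℝ W]
    [FiniteDimensional ℝ W] {γ : ℝ → W} {φ : ℝ → ℝ} {s : ℝ} {A : W →L[ℝ] W}
    (hγ : AnalyticAt ℝ γ s) (hγ' : deriv γ s ≠ 0) (hφ : AnalyticAt ℝ φ s) (hφs : φ s = s)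
    (hA : ∀ v, v ≠ 0 → A v ≠ 0) (hA' : ∀ v, v ≠ 0 → ‖A v‖ < ‖v‖)
    (h : ∀ᶠ t in 𝓝 s, γ (φ t) - γ s = A (γ t - γ s))
    (hnd : ∀ m : W →L[ℝ] ℝ, (∀ᶠ t in 𝓝 s, m (γ t) = m (γ s)) → m = 0) :
    ∃ (m : W →L[ℝ] ℝ) (D : Finset ℕ) (w : ℕ → W), 0 ∉ D ∧
      LinearIndependent ℝ (fun k : D => w k) ∧
      ∀ᶠ t in 𝓝 s, γ t = γ s + ∑ k ∈ D, (m (γ t - γ s)) ^ k • w k := by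
  obtain ⟨hc0, hc1, m, hm, hmA⟩ := exists_eigenfunctional hγ hγ' hφ hφs hA hA' h hnd
  set c := deriv φ s
  set u : ℝ → ℝ := fun t => m (γ t - γ s) with hu_def
  have hu : AnalyticAt ℝ u s := (m.analyticAt _).comp (hγ.sub analyticAt_const)
  have hus : u s = 0 := by simp [hu_def]
  have hud : deriv u s ≠ 0 := by
    have := (m.hasFDerivAt.comp_hasDerivAt s
      (hγ.differentiableAt.hasDerivAt.sub_const (γ s))).deriv
    exact fun h0 => hm (this.symm.trans h0)
  obtain ⟨T, hT, hTs, hl, hr⟩ := hu.exists_local_inverse hud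
  rw [hus] at hT hTs hr
  have hTc : Tendsto T (𝓝 0) (𝓝 s) := by
    have := hT.continuousAt.tendsto
    rwa [hTs] at this
  have hφc : Tendsto φ (𝓝 s) (𝓝 s) := by
    have := hφ.continuousAt.tendsto
    rwa [hφs] at this
  have hΓ : AnalyticAt ℝ (fun x => γ (T x)) 0 := by
    refine AnalyticAt.fun_comp (g := γ) ?_ hT
    rwa [hTs]
  have hscale : ∀ᶠ x in 𝓝 0, γ (T (c * x)) - γ (T 0) = A (γ (T x) - γ (T 0)) := by
    filter_upwards [hr, hTc.eventually h, (hφc.comp hTc).eventually hl] with x h1 h2 h3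
    have h4 : u (φ (T x)) = c * x := by
      rw [hu_def]
      simp only
      rw [h2, hmA]
      exact congrArg _ h1
    simp only [Function.comp] at h3
    rw [h4] at h3
    rw [hTs, h3, h2]
  obtain ⟨D, w, hD, hw, hev⟩ := exists_polynomial_of_scaling hΓ hc0 hc1 hscale
  refine ⟨m, D, w, hD, hw, ?_⟩
  have huc : Tendsto u (𝓝 s) (𝓝 0) := by
    have := hu.continuousAt.tendsto
    rwa [hus] at this
  filter_upwards [hl, huc.eventually hev] with t h1 h2
  rwa [h1, hTs] at h2

/-- The local polynomial expression extends to the whole curve by the identity theorem. -/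
lemma eqOn_Icc_of_local_polynomial {W : Type*} [NormedAddCommGroup W] [NormedSpace ℝ W]
    {γ : ℝ → W} {a b s : ℝ} (hc : ContinuousOn γ (Icc a b)) (ha : AnalyticOnNhd ℝ γ (Ioo a b))
    (hs : s ∈ Ioo a b) {m : W →L[ℝ] ℝ} {D : Finset ℕ} {w : ℕ → W}
    (h : ∀ᶠ t in 𝓝 s, γ t = γ s + ∑ k ∈ D, (m (γ t - γ s)) ^ k • w k) :
    EqOn γ (fun t => γ s + ∑ k ∈ D, (m (γ t - γ s)) ^ k • w k) (Icc a b) := by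
  have h1 : AnalyticOnNhd ℝ (fun t => γ s + ∑ k ∈ D, (m (γ t - γ s)) ^ k • w k) (Ioo a b) := by
    intro t ht
    have hm : AnalyticAt ℝ (fun t => m (γ t - γ s)) t :=
      (m.analyticAt _).comp ((ha t ht).sub analyticAt_const)
    exact analyticAt_const.add (Finset.analyticAt_fun_sum D fun k _ =>
      (hm.pow k).smul analyticAt_const)
  have h2 := ha.eqOn_of_preconnected_of_eventuallyEq h1 isPreconnected_Ioo hs h
  have hab : a ≠ b := (hs.1.trans hs.2).ne
  refine h2.of_subset_closure hc ?_ Ioo_subset_Icc_self (closure_Ioo hab).ge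
  fun_prop

/-! ### Self-affine subsets of a polynomial curve -/

/-- Suppose that an affine map `f` carries infinitely many points of the polynomial curve
`Γ x = z + ∑ x ^ k • w k` (`k ∈ D`) to points of the curve, with the
functional `m` giving the parameters of the images. Then `f` moves the curve along itself by an
affine change of parameter, and if that change does not fix `0`, no exponent below the degree is
missing. -/
lemma Icc_subset_of_affine_maps_polynomial {W : Type*} [NormedAddCommGroup W] [NormedSpace ℝ W]
    {z : W} {D : Finset ℕ} (hD : 0 ∉ D) (hDne : D.Nonempty) {w : ℕ → W} (b : Module.Basis D ℝ W)
    (hb : ∀ k : D, b k = w k) (m : W →L[ℝ] ℝ) (f : W ≃ᵃ[ℝ] W) {F : Set ℝ} (hF : F.Infinite)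
    (h : ∀ x ∈ F, f (z + ∑ k ∈ D, x ^ k • w k) =
      z + ∑ k ∈ D, (m (f (z + ∑ k ∈ D, x ^ k • w k) - z)) ^ k • w k)
    (hfz : f z ≠ z) : D = Finset.Icc 1 (D.max' hDne) := by
  classical
  set N := D.max' hDne
  have hND : N ∈ D := D.max'_mem hDne
  have hle : ∀ k ∈ D, k ≤ N := fun k hk => D.le_max' k hk
  set Γ : ℝ → W := fun x => z + ∑ k ∈ D, x ^ k • w k with hΓ
  have hΓ0 : Γ 0 = z := by
    rw [hΓ]
    simp only
    rw [Finset.sum_eq_zero fun k hk => by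
      rw [zero_pow (fun h0 => hD (h0 ▸ hk)), zero_smul], add_zero]
  have hfΓ : ∀ x, f (Γ x) - z = (f z - z) + ∑ k ∈ D, x ^ k • f.linear (w k) := fun x => by
    have h1 : f (Γ x) = f.linear (∑ k ∈ D, x ^ k • w k) + f z := by
      have := f.map_vadd z (∑ k ∈ D, x ^ k • w k)
      rwa [vadd_eq_add, vadd_eq_add, add_comm _ z] at this
    rw [h1, map_sum]
    simp only [map_smul]
    abel
  let Q : (W →ₗ[ℝ] ℝ) → Polynomial ℝ := fun μ => Polynomial.C (μ (f z - z)) +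
    ∑ k ∈ D, Polynomial.C (μ (f.linear (w k))) * Polynomial.X ^ k
  have hQ : ∀ μ x, (Q μ).eval x = μ (f (Γ x) - z) := fun μ x => by
    rw [hfΓ, map_add, map_sum]
    simp only [Q, Polynomial.eval_add, Polynomial.eval_C, Polynomial.eval_finsetSum,
      Polynomial.eval_mul, Polynomial.eval_pow, Polynomial.eval_X, map_smul, smul_eq_mul, mul_comm]
  set P := Q m.toLinearMap
  have hPx : ∀ x, P.eval x = m (f (Γ x) - z) := fun x => hQ _ x
  have hpoly : ∀ μ : W →ₗ[ℝ] ℝ, Q μ = ∑ k ∈ D, Polynomial.C (μ (w k)) * P ^ k := fun μ => by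
    refine Polynomial.eq_of_infinite_eval_eq _ _ (hF.mono fun x hx => ?_)
    have h1 : f (Γ x) - z = ∑ k ∈ D, (P.eval x) ^ k • w k := by
      rw [hPx]
      exact sub_eq_iff_eq_add'.2 (h x hx)
    rw [mem_ofPred_eq, hQ, h1, map_sum]
    simp [Polynomial.eval_finsetSum, mul_comm]
  have hglob : ∀ x, f (Γ x) = Γ (P.eval x) := fun x => by
    have h1 : f (Γ x) - z = ∑ k ∈ D, (P.eval x) ^ k • w k := by
      refine b.ext_elem fun i => ?_
      have h2 := hQ (b.coord i) x
      rw [hpoly] at h2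
      rw [← b.coord_apply, ← b.coord_apply, ← h2, map_sum]
      simp [Polynomial.eval_finsetSum, mul_comm]
    exact sub_eq_iff_eq_add'.1 h1
  -- the top coordinate shows that `P ^ N` is a combination of `1` and the `X ^ k` with `k ∈ D`
  have hPN : Q (b.coord ⟨N, hND⟩) = P ^ N := by
    rw [hpoly, Finset.sum_eq_single N]
    · rw [← hb ⟨N, hND⟩]
      simp
    · intro k hk hkN
      rw [← hb ⟨k, hk⟩]
      simp [hkN]
    · exact fun hn => absurd hND hn
  have hN0 : N ≠ 0 := fun h0 => hD (h0 ▸ hND)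
  have hdeg : P.natDegree ≤ 1 := by
    have h1 : (P ^ N).natDegree ≤ N := by
      rw [← hPN]
      refine Polynomial.natDegree_add_le_of_degree_le (by simp)
        (Polynomial.natDegree_sum_le_of_forall_le _ _ fun k hk => ?_)
      exact (Polynomial.natDegree_C_mul_X_pow_le _ _).trans (hle k hk)
    rw [Polynomial.natDegree_pow] at h1
    exact Nat.le_of_mul_le_mul_left (by linarith) (Nat.pos_of_ne_zero hN0)
  have hPlin := Polynomial.eq_X_add_C_of_natDegree_le_one hdeg
  set α := P.coeff 1
  set β := P.coeff 0
  have hβ : β ≠ 0 := fun h0 => hfz <| by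
    have := hglob 0
    rwa [hPlin, h0, Polynomial.eval_add, Polynomial.eval_C_mul, Polynomial.eval_X, mul_zero,
      Polynomial.eval_C, add_zero, hΓ0] at this
  have hα : α ≠ 0 := fun h0 => by
    -- otherwise `Γ` would be constant
    have hc : ∀ x, Γ x = Γ 0 := fun x => f.injective <| by
      rw [hglob, hglob, hPlin, h0]
      simp
    have h1 := congrArg (fun v => b.repr v ⟨N, hND⟩) (add_left_cancel ((hc 1).trans hΓ0
      |>.trans (add_zero z).symm))
    simp only [one_pow, one_smul] at h1
    rw [← Finset.sum_coe_sort] at h1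
    simp only [← hb] at h1
    simp [Finsupp.single_apply] at h1
  ext j
  rw [Finset.mem_Icc]
  refine ⟨fun hj => ⟨Nat.one_le_iff_ne_zero.2 fun h0 => hD (h0 ▸ hj), hle j hj⟩, fun hj => ?_⟩
  by_contra hjD
  have hj0 : j ≠ 0 := Nat.one_le_iff_ne_zero.1 hj.1
  have h1 : (P ^ N).coeff j = 0 := by
    rw [← hPN]
    simp only [Q, Polynomial.coeff_add, Polynomial.finsetSum_coeff, Polynomial.coeff_C_mul,
      Polynomial.coeff_X_pow, Polynomial.coeff_C, hj0, if_false, zero_add]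
    refine Finset.sum_eq_zero fun k hk => ?_
    rw [if_neg (fun h0 : j = k => hjD (h0 ▸ hk)), mul_zero]
  have h2 : P = Polynomial.C α * (Polynomial.X + Polynomial.C (β / α)) := by
    rw [mul_add, ← Polynomial.C_mul, mul_div_cancel₀ _ hα]
    exact hPlin
  rw [h2, mul_pow, ← Polynomial.C_pow, Polynomial.coeff_C_mul, Polynomial.coeff_X_add_C_pow] at h1
  have h3 : (N.choose j : ℝ) ≠ 0 := by exact_mod_cast (Nat.choose_pos hj.2).ne'
  exact mul_ne_zero (pow_ne_zero _ hα) (mul_ne_zero (pow_ne_zero _ (div_ne_zero hβ hα)) h3) h1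

/-! ### A fixed point on a regular invariant branch -/

lemma AnalyticOnNhd.eq_of_frequently_deriv_eq_zero {W : Type*} [NormedAddCommGroup W]
    [NormedSpace ℝ W] [CompleteSpace W] {γ : ℝ → W} {a b p : ℝ} (hab : a < b)
    (hc : ContinuousOn γ (Icc a b)) (ha : AnalyticOnNhd ℝ γ (Ioo a b)) (hp : p ∈ Ioo a b)
    (h : ∃ᶠ t in 𝓝[≠] p, deriv γ t = 0) : ∀ t ∈ Icc a b, γ t = γ p := by
  have h0 : EqOn (deriv γ) 0 (Ioo a b) :=
    ha.deriv.eqOn_zero_of_preconnected_of_frequently_eq_zero isPreconnected_Ioo hp h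
  have h1 : EqOn γ (fun _ => γ p) (Ioo a b) := fun t ht =>
    isOpen_Ioo.is_const_of_deriv_eq_zero isPreconnected_Ioo ha.differentiableOn h0 ht hp
  exact fun t ht => h1.of_subset_closure hc continuousOn_const Ioo_subset_Icc_self
    (closure_Ioo hab.ne).ge ht

/-- The singular parameters can only accumulate at the end points, so an infinite subset of the
curve all of whose small pieces are infinite has a point away from all singular values. -/
lemma exists_open_regular {W : Type*} [NormedAddCommGroup W]
    [NormedSpace ℝ W] [CompleteSpace W] {γ : ℝ → W} {a b : ℝ} (hab : a < b)
    (hc : ContinuousOn γ (Icc a b)) (ha : AnalyticOnNhd ℝ γ (Ioo a b))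
    (hn : ∃ s ∈ Icc a b, ∃ t ∈ Icc a b, γ s ≠ γ t) {E : Set W} (hE : E.Infinite)
    (hsmall : ∀ x ∈ E, ∀ U ∈ 𝓝 x, (E ∩ U).Infinite) :
    ∃ y ∈ E, ∃ V : Set W, IsOpen V ∧ y ∈ V ∧
      ∀ t ∈ Icc a b, γ t ∈ V → t ∈ Ioo a b ∧ deriv γ t ≠ 0 := by
  obtain ⟨x, hxE, hx⟩ := (hE.sdiff (Set.toFinite {γ a, γ b})).nonempty
  obtain ⟨r, hr, hrx⟩ := Metric.nhds_basis_closedBall.mem_iff.1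
    ((Set.toFinite {γ a, γ b}).isClosed.isOpen_compl.mem_nhds hx)
  set C := Icc a b ∩ γ ⁻¹' Metric.closedBall x r
  have hCc : IsCompact C := isCompact_Icc.of_isClosed_subset
    (hc.preimage_isClosed_of_isClosed isClosed_Icc Metric.isClosed_closedBall) inter_subset_left
  have hCI : C ⊆ Ioo a b := fun t ht => by
    have h1 := hrx ht.2
    simp only [mem_compl_iff, mem_insert_iff, mem_singleton_iff, not_or] at h1
    exact ⟨lt_of_le_of_ne ht.1.1 fun h => h1.1 (h ▸ rfl),
      lt_of_le_of_ne ht.1.2 fun h => h1.2 (h ▸ rfl)⟩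
  set Z := {t ∈ C | deriv γ t = 0}
  have hZfin : Z.Finite := by
    by_contra hinf
    obtain ⟨p, hpC, hp⟩ := Set.Infinite.exists_accPt_of_subset_isCompact hinf hCc (sep_subset _ _)
    have h1 := ha.eq_of_frequently_deriv_eq_zero hab hc (hCI hpC)
      ((accPt_iff_frequently_nhdsNE.1 hp).mono fun t ht => ht.2)
    obtain ⟨s, hs, t, ht, hst⟩ := hn
    exact hst ((h1 s hs).trans (h1 t ht).symm)
  obtain ⟨y, ⟨hyE, hyU⟩, hyZ⟩ := ((hsmall x hxE _ (Metric.ball_mem_nhds x hr)).sdiff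
    (hZfin.image γ)).nonempty
  refine ⟨y, hyE, Metric.ball x r \ γ '' Z, Metric.isOpen_ball.sdiff (hZfin.image γ).isClosed,
    ⟨hyU, hyZ⟩, fun t ht htV => ?_⟩
  have htC : t ∈ C := ⟨ht, Metric.ball_subset_closedBall htV.1⟩
  exact ⟨hCI htC, fun h0 => htV.2 ⟨t, ⟨htC, h0⟩, rfl⟩⟩

lemma AffineEquiv.exists_continuousLinearMap {W : Type*} [NormedAddCommGroup W] [NormedSpace ℝ W]
    [FiniteDimensional ℝ W] (g : W ≃ᵃ[ℝ] W) :
    ∃ A : W →L[ℝ] W, Function.Injective A ∧ ∀ x y, g x - g y = A (x - y) :=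
  ⟨LinearMap.toContinuousLinearMap g.linear.toLinearMap, g.linear.injective,
    fun x y => (g.toAffineMap.linearMap_vsub x y).symm⟩

lemma exists_affineEquiv_iterate {W : Type*} [NormedAddCommGroup W] [NormedSpace ℝ W]
    (g : W ≃ᵃ[ℝ] W) (q : ℕ) : ∃ G : W ≃ᵃ[ℝ] W, ⇑G = g^[q] := by
  induction q with
  | zero => exact ⟨AffineEquiv.refl ℝ W, rfl⟩
  | succ q ih =>
    obtain ⟨G, hG⟩ := ih
    exact ⟨g.trans G, by rw [AffineEquiv.coe_trans, hG, Function.iterate_succ]⟩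

/-- Some power `G` of `g` fixes a germ of the curve. Several branches of the curve may pass
through the fixed point of `g`, but only finitely many: along an ultrafilter, the parameters of an
orbit and of its shifts converge to finitely many values, so two shifts have the same limit. -/
lemma exists_invariant_germ {W : Type*} [NormedAddCommGroup W] [NormedSpace ℝ W]
    [FiniteDimensional ℝ W] {γ : ℝ → W} {a b : ℝ} (hc : ContinuousOn γ (Icc a b))
    (ha : AnalyticOnNhd ℝ γ (Ioo a b)) {E V : Set W} (hE : E.Infinite) (hEc : IsClosed E)
    (hEγ : E ⊆ γ '' Icc a b) (hV : ∀ t ∈ Icc a b, γ t ∈ V → t ∈ Ioo a b ∧ deriv γ t ≠ 0)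
    {K : NNReal} {g : W ≃ᵃ[ℝ] W} (hg : ContractingWith K g) (hgE : MapsTo g E E)
    (hgV : MapsTo g E V) :
    ∃ (G : W ≃ᵃ[ℝ] W) (K' : NNReal) (s : ℝ) (φ : ℝ → ℝ), ContractingWith K' G ∧
      G (γ s) = γ s ∧ s ∈ Ioo a b ∧ deriv γ s ≠ 0 ∧ AnalyticAt ℝ φ s ∧ φ s = s ∧
      ∀ᶠ t in 𝓝 s, G (γ t) = γ (φ t) := by
  obtain ⟨z, hzE, hz, hlim⟩ := hg.exists_fixedPoint_mem hEc hE.nonempty hgE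
  have hzV : z ∈ V := hz ▸ hgV hzE
  obtain ⟨e, heE, hez⟩ := (hE.sdiff (Set.finite_singleton z)).nonempty
  have horb : ∀ k, g^[k] e ≠ z := fun k h => hez <| g.injective.iterate k <| by
    rw [h, Function.iterate_fixed hz]
  choose t ht htγ using fun k => hEγ (hgE.iterate k heE)
  have hlimU : ∀ q : ℕ, ∃ s ∈ Icc a b,
      Tendsto (fun k : ℕ => t (k + q)) (hyperfilter ℕ : Filter ℕ) (𝓝 s) := fun q =>
    isCompact_Icc.ultrafilter_le_nhds ((hyperfilter ℕ).map fun k : ℕ => t (k + q))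
      ((tendsto_principal (f := fun k : ℕ => t (k + q))).2
        (Eventually.of_forall fun k => ht (k + q)))
  choose σ hσ hσt using hlimU
  have hσz : ∀ q, γ (σ q) = z := fun q => by
    have h1 : Tendsto (fun k => γ (t (k + q))) (hyperfilter ℕ : Filter ℕ) (𝓝 (γ (σ q))) :=
      (hc (σ q) (hσ q)).tendsto.comp (tendsto_nhdsWithin_iff.2
        ⟨hσt q, Eventually.of_forall fun k => ht (k + q)⟩)
    refine tendsto_nhds_unique h1 ?_
    simp only [htγ]
    exact ((hlim e).comp (tendsto_add_atTop_nat q)).mono_left Nat.hyperfilter_le_atTop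
  set P := {s ∈ Icc a b | γ s = z}
  have hPgood : ∀ s ∈ P, s ∈ Ioo a b ∧ deriv γ s ≠ 0 := fun s hs => hV s hs.1 (hs.2 ▸ hzV)
  have hPc : IsCompact P := isCompact_Icc.of_isClosed_subset
    (hc.preimage_isClosed_of_isClosed isClosed_Icc (isClosed_singleton (x := z))) inter_subset_left
  have hPfin : P.Finite := by
    by_contra hinf
    obtain ⟨p, hpP, hp⟩ := Set.Infinite.exists_accPt_of_subset_isCompact hinf hPc subset_rfl
    have h1 : ∀ᶠ t in 𝓝 p, γ t = z :=
      ((ha p (hPgood p hpP).1).frequently_eq_iff_eventually_eq analyticAt_const).1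
        ((accPt_iff_frequently_nhdsNE.1 hp).mono fun t ht => ht.2)
    exact (hPgood p hpP).2 ((EventuallyEq.deriv_eq h1).trans (deriv_const p z))
  have hσP : MapsTo σ univ P := fun q _ => ⟨hσ q, hσz q⟩
  obtain ⟨q, -, q', -, hqq, hσq⟩ := Set.infinite_univ.exists_ne_map_eq_of_mapsTo hσP hPfin
  wlog hlt : q < q' generalizing q q'
  · exact this q' q hqq.symm hσq.symm (lt_of_le_of_ne (not_lt.1 hlt) hqq.symm)
  obtain ⟨hsI, hsd⟩ := hPgood (σ q) (hσP (mem_univ q))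
  obtain ⟨G, hG⟩ := exists_affineEquiv_iterate g (q' - q)
  have hGan : ∀ x, AnalyticAt ℝ γ x → AnalyticAt ℝ (fun t => G (γ t)) x := fun x hx => by
    obtain ⟨A, -, hA⟩ := G.exists_continuousLinearMap
    have h1 : (fun t => G (γ t)) = fun t => A (γ t - z) + G z := by
      funext t
      rw [← hA, sub_add_cancel]
    rw [h1]
    exact ((A.analyticAt _).comp (hx.sub analyticAt_const)).add analyticAt_const
  have hGt : ∀ k, G (γ (t (k + q))) = γ (t (k + q')) := fun k => by
    rw [htγ, htγ, hG, ← Function.iterate_add_apply, show q' - q + (k + q) = k + q' by omega]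
  obtain ⟨φ, hφ, hφs, hev⟩ := exists_analytic_reparam (F := (hyperfilter ℕ : Filter ℕ))
    (hGan _ (ha _ hsI)) (ha _ hsI) hsd
    (tendsto_nhdsWithin_iff.2 ⟨hσt q, Eventually.of_forall fun k h =>
      horb (k + q) (by rw [← htγ, h, hσz])⟩) (hσq ▸ hσt q') (Eventually.of_forall hGt)
  refine ⟨G, K ^ (q' - q), σ q, φ, ⟨pow_lt_one₀ zero_le hg.1 (by omega), ?_⟩, ?_, hsI, hsd, hφ,
    hφs, hev⟩
  · rw [hG]; exact hg.2.iterate _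
  · rw [hσz, hG, Function.iterate_fixed hz]

/-! ### Arcs of the moment curve are self-affine -/

/-- The linear part of the affine map of `ℝⁿ` that acts on the moment curve as the change of
parameter `t ↦ α * t + β`. -/
noncomputable def momentLinear (n : ℕ) (α β : ℝ) :
    EuclideanSpace ℝ (Fin n) →ₗ[ℝ] EuclideanSpace ℝ (Fin n) :=
  Matrix.toLpLin 2 2 (Matrix.of fun i j : Fin n =>
    α ^ ((j : ℕ) + 1) * β ^ ((i : ℕ) - j) * (((i : ℕ) + 1).choose ((j : ℕ) + 1) : ℝ))

lemma momentCurve_affine (n : ℕ) (α β t : ℝ) :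
    momentCurve n (α * t + β) = momentLinear n α β (momentCurve n t) + momentCurve n β := by
  ext i
  simp only [momentLinear, momentCurve, PiLp.add_apply, Matrix.toLpLin_apply, Matrix.mulVec,
    dotProduct, Matrix.of_apply]
  rw [add_pow, Finset.sum_range_succ']
  congr 1
  · rw [Fin.sum_univ_eq_sum_range (fun j => α ^ (j + 1) * β ^ ((i : ℕ) - j) *
      (((i : ℕ) + 1).choose (j + 1) : ℝ) * t ^ (j + 1)) n]
    refine Finset.sum_subset_zero_on_sdiff ?_ ?_ ?_
    · intro j hj
      simp only [Finset.mem_range] at hj ⊢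
      omega
    · intro j hj
      rw [Finset.mem_sdiff, Finset.mem_range, Finset.mem_range] at hj
      rw [Nat.choose_eq_zero_of_lt (by omega)]
      simp
    · intro j _
      rw [mul_pow, Nat.add_sub_add_right]
      ring
  · simp

lemma momentLinear_injective {n : ℕ} {α : ℝ} (hα : α ≠ 0) (β : ℝ) :
    Function.Injective (momentLinear n α β) := by
  set M := Matrix.of fun i j : Fin n =>
    α ^ ((j : ℕ) + 1) * β ^ ((i : ℕ) - j) * (((i : ℕ) + 1).choose ((j : ℕ) + 1) : ℝ) with hM
  have htri : M.IsLowerTriangular := fun i j hij => by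
    have hij' : (i : ℕ) < j := hij
    simp [hM, Nat.choose_eq_zero_of_lt (Nat.succ_lt_succ hij')]
  have hdet : IsUnit M := by
    rw [Matrix.isUnit_iff_isUnit_det, Matrix.det_of_isLowerTriangular M htri, isUnit_iff_ne_zero]
    exact Finset.prod_ne_zero_iff.2 fun i _ => by simp [hM, hα]
  have hinj := Matrix.mulVec_injective_iff_isUnit.2 hdet
  intro v w hvw
  rw [momentLinear, ← hM, Matrix.toLpLin_apply, Matrix.toLpLin_apply] at hvw
  exact (WithLp.ofLp_injective 2) (hinj (WithLp.toLp_injective 2 hvw))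

lemma norm_momentLinear_le {n : ℕ} {α β B : ℝ} (hα : |α| ≤ 1) (hB : 1 ≤ B) (hβ : |β| ≤ B)
    (v : EuclideanSpace ℝ (Fin n)) :
    ‖momentLinear n α β v‖ ≤ |α| * (n * n * (B ^ n * 2 ^ n)) * ‖v‖ := by
  have hentry : ∀ i j : Fin n, |α ^ ((j : ℕ) + 1) * β ^ ((i : ℕ) - j) *
      (((i : ℕ) + 1).choose ((j : ℕ) + 1) : ℝ)| ≤ |α| * (B ^ n * 2 ^ n) := fun i j => by
    rw [abs_mul, abs_mul, abs_pow, abs_pow, Nat.abs_cast, mul_assoc]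
    have h1 : |α| ^ ((j : ℕ) + 1) ≤ |α| := pow_le_of_le_one (abs_nonneg _) hα (Nat.succ_ne_zero _)
    have h2 : |β| ^ ((i : ℕ) - j) ≤ B ^ n := (pow_le_pow_left₀ (abs_nonneg _) hβ _).trans
      (pow_le_pow_right₀ hB (by omega))
    have h3 : (((i : ℕ) + 1).choose ((j : ℕ) + 1) : ℝ) ≤ 2 ^ n := by
      exact_mod_cast (Nat.choose_le_two_pow _ _).trans (Nat.pow_le_pow_right two_pos i.2)
    gcongr
  have hcoord : ∀ i, ‖momentLinear n α β v i‖ ≤ n * (|α| * (B ^ n * 2 ^ n) * ‖v‖) := fun i => by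
    simp only [momentLinear, Matrix.toLpLin_apply, Matrix.mulVec, dotProduct, Matrix.of_apply]
    refine (norm_sum_le _ _).trans ((Finset.sum_le_card_nsmul _ _
      (|α| * (B ^ n * 2 ^ n) * ‖v‖) fun j _ => ?_).trans (by simp))
    rw [norm_mul]
    exact mul_le_mul (hentry i j) (PiLp.norm_apply_le v j) (norm_nonneg _) (by positivity)
  have hsum : momentLinear n α β v =
      ∑ i, momentLinear n α β v i • EuclideanSpace.single i (1 : ℝ) := by
    ext j
    simp [Finset.sum_apply, Pi.single_apply]
  rw [hsum]
  refine (norm_sum_le _ _).trans ((Finset.sum_le_card_nsmul _ _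
    (n * (|α| * (B ^ n * 2 ^ n) * ‖v‖)) fun i _ => ?_).trans (le_of_eq ?_))
  · rw [norm_smul, PiLp.norm_single, norm_one, mul_one]
    exact hcoord i
  · simp
    ring

/-- The change of parameter `t ↦ α * t + β` on an affine image of the moment curve is induced by
an affine map, whose Lipschitz constant is of order `α`. -/
lemma exists_affineEquiv_momentCurve {n : ℕ}
    (f : EuclideanSpace ℝ (Fin n) ≃ᵃ[ℝ] EuclideanSpace ℝ (Fin n)) {B : ℝ} (hB : 1 ≤ B) :
    ∃ C : ℝ, 0 ≤ C ∧ ∀ α β : ℝ, α ≠ 0 → |α| ≤ 1 → |β| ≤ B →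
      ∃ g : EuclideanSpace ℝ (Fin n) ≃ᵃ[ℝ] EuclideanSpace ℝ (Fin n),
        (∀ t, g (f (momentCurve n t)) = f (momentCurve n (α * t + β))) ∧
        ∀ x y, dist (g x) (g y) ≤ |α| * C * dist x y := by
  obtain ⟨A, -, hA⟩ := f.exists_continuousLinearMap
  obtain ⟨A', -, hA'⟩ := f.symm.exists_continuousLinearMap
  refine ⟨‖A‖ * (n * n * (B ^ n * 2 ^ n)) * ‖A'‖, by positivity, fun α β h0 hα hβ => ?_⟩
  let S : EuclideanSpace ℝ (Fin n) ≃ᵃ[ℝ] EuclideanSpace ℝ (Fin n) :=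
    (LinearEquiv.ofInjectiveEndo _ (momentLinear_injective h0 β)).toAffineEquiv.trans
      (AffineEquiv.constVAdd ℝ _ (momentCurve n β))
  have hSx : ∀ x, S x = momentLinear n α β x + momentCurve n β := fun x => by
    rw [AffineEquiv.trans_apply, AffineEquiv.constVAdd_apply, vadd_eq_add, add_comm]
    rfl
  clear_value S
  refine ⟨f.symm.trans (S.trans f), fun t => ?_, fun x y => ?_⟩
  · rw [AffineEquiv.trans_apply, AffineEquiv.trans_apply, AffineEquiv.symm_apply_apply, hSx,
      momentCurve_affine]
  · rw [AffineEquiv.trans_apply, AffineEquiv.trans_apply, AffineEquiv.trans_apply,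
      AffineEquiv.trans_apply, dist_eq_norm, dist_eq_norm, hA, hSx, hSx, add_sub_add_right_eq_sub,
      ← map_sub, hA']
    calc _ ≤ ‖A‖ * (|α| * (n * n * (B ^ n * 2 ^ n)) * (‖A'‖ * ‖x - y‖)) :=
          (A.le_opNorm _).trans (mul_le_mul_of_nonneg_left
            ((norm_momentLinear_le hα hB hβ _).trans
              (mul_le_mul_of_nonneg_left (A'.le_opNorm _) (by positivity))) (norm_nonneg _))
      _ = _ := by ring

/-- Every affine image of an arc of the moment curve is the union of arbitrarily small affine
copies of itself. Conjugation by `f` may spoil the contraction ratio of a map, which is why the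
subdivision has to depend on `f`. -/
lemma isSelfAffine_image_momentCurve {n : ℕ}
    (f : EuclideanSpace ℝ (Fin n) ≃ᵃ[ℝ] EuclideanSpace ℝ (Fin n)) {c d : ℝ} (hcd : c < d) :
    IsSelfAffine ((f ∘ momentCurve n) '' Icc c d) := by
  have hcont : Continuous (f ∘ momentCurve n) := by
    refine f.continuous_of_finiteDimensional.comp ?_
    unfold momentCurve
    fun_prop
  refine ⟨(nonempty_Icc.2 hcd.le).image _, isCompact_Icc.image hcont, ?_⟩
  obtain ⟨C, hC0, hC⟩ := exists_affineEquiv_momentCurve f (B := 1 + 2 * |c| + (d - c))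
    (by linarith [abs_nonneg c])
  -- with `N > C` pieces, each copy has contraction ratio at most `C / N < 1`
  obtain ⟨N, hN⟩ := exists_nat_gt (C + 1)
  have hN0 : (0 : ℝ) < N := by linarith
  have hN1 : (1 : ℝ) ≤ N := by linarith
  have hinv : |(1 / N : ℝ)| = 1 / N := abs_of_pos (by positivity)
  have hle1 : (1 / N : ℝ) ≤ 1 := (div_le_one hN0).2 hN1
  set β : Fin N → ℝ := fun k => c + (k : ℕ) / N * (d - c) - 1 / N * c with hβ
  have hβB : ∀ k, |β k| ≤ 1 + 2 * |c| + (d - c) := fun k => by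
    have hk : ((k : ℕ) : ℝ) / N ≤ 1 := (div_le_one hN0).2 (by exact_mod_cast k.2.le)
    have hk0 : 0 ≤ ((k : ℕ) : ℝ) / N := by positivity
    have h1 : |((k : ℕ) : ℝ) / N * (d - c)| ≤ d - c := by
      rw [abs_of_nonneg (mul_nonneg hk0 (by linarith))]
      exact mul_le_of_le_one_left (by linarith) hk
    have h2 : |1 / N * c| ≤ |c| := by
      rw [abs_mul, hinv]
      exact mul_le_of_le_one_left (abs_nonneg _) hle1
    linarith [abs_sub (c + (k : ℕ) / N * (d - c)) (1 / N * c),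
      abs_add_le c ((k : ℕ) / N * (d - c))]
  choose g hg hgd using fun k => hC (1 / N) (β k) (by positivity) (hinv.trans_le hle1) (hβB k)
  refine ⟨N, g, fun k x y hxy => (hgd k x y).trans_lt ?_, ?_⟩
  · refine mul_lt_of_lt_one_left (dist_pos.2 hxy) ?_
    rw [hinv, div_mul_eq_mul_div, one_mul, div_lt_one hN0]
    linarith
  have hdc : 0 < d - c := sub_pos.2 hcd
  ext x
  simp only [mem_iUnion, mem_image, exists_exists_and_eq_and, Function.comp, hg]
  constructor
  · rintro ⟨t, ht, rfl⟩
    -- `t` lies in the subinterval number `⌊N (t - c) / (d - c)⌋`, or in the last one if `t = d`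
    obtain ⟨k, hk1, hk2⟩ : ∃ k : Fin N, (k : ℕ) ≤ N * (t - c) / (d - c) ∧
        N * (t - c) / (d - c) ≤ (k : ℕ) + 1 := by
      have h0 : 0 ≤ N * (t - c) / (d - c) := by
        have := ht.1
        exact div_nonneg (mul_nonneg hN0.le (by linarith)) hdc.le
      have h1 : N * (t - c) / (d - c) ≤ N := by
        rw [div_le_iff₀ hdc]
        exact mul_le_mul_of_nonneg_left (by linarith [ht.2]) hN0.le
      have hNpos : 0 < N := by exact_mod_cast hN0
      rcases h1.lt_or_eq with h2 | h2
      · exact ⟨⟨⌊N * (t - c) / (d - c)⌋₊, (Nat.floor_lt h0).2 h2⟩, Nat.floor_le h0,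
          (Nat.lt_floor_add_one _).le⟩
      · refine ⟨⟨N - 1, by omega⟩, ?_, ?_⟩
        · rw [h2]
          exact_mod_cast Nat.sub_le N 1
        · rw [h2]
          exact_mod_cast (by omega : N ≤ N - 1 + 1)
    rw [le_div_iff₀ hdc] at hk1
    rw [div_le_iff₀ hdc] at hk2
    refine ⟨k, N * (t - β k), ⟨?_, ?_⟩, ?_⟩
    · have : N * (t - β k) = N * (t - c) - (k : ℕ) * (d - c) + c := by
        simp only [hβ]; field_simp; ring
      linarith
    · have : N * (t - β k) = N * (t - c) - (k : ℕ) * (d - c) + c := by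
        simp only [hβ]; field_simp; ring
      linarith
    · congr 2
      field_simp
      ring
  · rintro ⟨k, t, ht, rfl⟩
    have hk : ((k : ℕ) : ℝ) + 1 ≤ N := by exact_mod_cast k.2
    have hval : 1 / N * t + β k = c + ((k : ℕ) * (d - c) + (t - c)) / N := by
      simp only [hβ]; field_simp; ring
    refine ⟨_, ⟨?_, ?_⟩, rfl⟩
    · rw [hval]
      have : 0 ≤ ((k : ℕ) * (d - c) + (t - c)) / (N : ℝ) :=
        div_nonneg (add_nonneg (by positivity) (by linarith [ht.1])) hN0.le
      linarith
    · rw [hval]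
      have : ((k : ℕ) * (d - c) + (t - c)) / (N : ℝ) ≤ d - c := by
        rw [div_le_iff₀ hN0]
        nlinarith [ht.2]
      linarith

/-! ### Analytic curves containing self-affine sets -/

lemma IsAnalyticCurve.analyticOnNhd {n : ℕ} {a b : ℝ} {γ : ℝ → EuclideanSpace ℝ (Fin n)}
    (h : IsAnalyticCurve a b γ) : AnalyticOnNhd ℝ γ (Ioo a b) := fun t ht =>
  ((PiLp.continuousLinearEquiv 2 ℝ fun _ : Fin n => ℝ).symm.toContinuousLinearMap.analyticAt
    _).comp (analyticAt_pi_iff.2 fun i => h.analytic i t ht)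

/-- A functional which is constant on a set not contained in a hyperplane vanishes. -/
lemma eq_zero_of_forall_eq {n : ℕ} {S : Set (EuclideanSpace ℝ (Fin n))}
    (hS : ¬ ∃ H, IsAffineHyperplane H ∧ S ⊆ H) (m : EuclideanSpace ℝ (Fin n) →L[ℝ] ℝ) (r : ℝ)
    (hm : ∀ x ∈ S, m x = r) : m = 0 := by
  by_contra hne
  refine hS ⟨_, ⟨(InnerProductSpace.toDual ℝ _).symm m, r, ?_, rfl⟩, fun x hx => ?_⟩
  · simpa using hne
  · rw [mem_ofPred_eq, InnerProductSpace.toDual_symm_apply, hm x hx]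

/-- The maps generating an infinite self-affine set have no common fixed point: a point of the set
farthest from such a fixed point would coincide with it. -/
lemma exists_map_ne {W : Type*} [MetricSpace W] {l : ℕ} {f : Fin l → W → W} {E : Set W}
    (hE : IsCompact E) (hEf : E = ⋃ i, f i '' E) {K : NNReal} (hK : K < 1)
    (hf : ∀ i, LipschitzWith K (f i)) (hinf : E.Infinite) (z : W) : ∃ i, f i z ≠ z := by
  by_contra! hfix
  obtain ⟨y, hyE, hmax⟩ := hE.exists_isMaxOn hinf.nonempty
    (show Continuous fun x => dist x z by fun_prop).continuousOn
  have hy : dist y z = 0 := by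
    have hyE' := hyE
    rw [hEf] at hyE'
    obtain ⟨i, y', hy', hyy⟩ := mem_iUnion.1 hyE'
    have h1 := (hf i).dist_le_mul y' z
    rw [hyy, hfix] at h1
    have h2 : dist y' z ≤ dist y z := hmax hy'
    have hK' : (K : ℝ) < 1 := by exact_mod_cast hK
    nlinarith [dist_nonneg (x := y) (y := z), K.2]
  refine hinf ((Set.finite_singleton z).subset fun x hx => ?_)
  have h1 : dist x z ≤ dist y z := hmax hx
  exact dist_le_zero.1 (h1.trans hy.le)

/-- An analytic curve spanning the space and containing a non-trivial self-affine set is a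
polynomial curve in a suitable linear parameter `m`. -/
lemma IsAnalyticCurve.exists_polynomial {n : ℕ} {a b : ℝ} {γ : ℝ → EuclideanSpace ℝ (Fin n)}
    (hγ : IsAnalyticCurve a b γ) (hnd : ¬ ∃ H, IsAffineHyperplane H ∧ γ '' Icc a b ⊆ H)
    {E : Set (EuclideanSpace ℝ (Fin n))} (hEγ : E ⊆ γ '' Icc a b) (hEc : IsCompact E)
    (hEinf : E.Infinite)
    (hsmall : ∀ x ∈ E, ∀ U ∈ 𝓝 x,
      ∃ (K : NNReal) (g : EuclideanSpace ℝ (Fin n) ≃ᵃ[ℝ] EuclideanSpace ℝ (Fin n)),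
        ContractingWith K g ∧ MapsTo g E E ∧ MapsTo g E U) :
    ∃ (s : ℝ) (m : EuclideanSpace ℝ (Fin n) →L[ℝ] ℝ) (D : Finset ℕ)
      (w : ℕ → EuclideanSpace ℝ (Fin n)), 0 ∉ D ∧ LinearIndependent ℝ (fun k : D => w k) ∧
      EqOn γ (fun t => γ s + ∑ k ∈ D, (m (γ t - γ s)) ^ k • w k) (Icc a b) := by
  have ha := hγ.analyticOnNhd
  obtain ⟨y, hyE, V, hVo, hyV, hV⟩ := exists_open_regular hγ.lt hγ.continuousOn ha
    hγ.nonconstant hEinf fun x hx U hU => by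
      obtain ⟨K, g, -, hgE, hgU⟩ := hsmall x hx U hU
      refine (hEinf.image g.injective.injOn).mono ?_
      rintro _ ⟨e, he, rfl⟩
      exact ⟨hgE he, hgU he⟩
  obtain ⟨K, g, hg, hgE, hgV⟩ := hsmall y hyE V (hVo.mem_nhds hyV)
  obtain ⟨G, K', s, φ, hG, hGs, hs, hsd, hφ, hφs, hev⟩ := exists_invariant_germ hγ.continuousOn ha
    hEinf hEc.isClosed hEγ hV hg hgE hgV
  obtain ⟨A, hAinj, hA⟩ := G.exists_continuousLinearMap
  obtain ⟨m, D, w, hD, hw, hloc⟩ := exists_local_polynomial (A := A) (ha s hs) hsd hφ hφs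
    (fun v hv h0 => hv (hAinj (h0.trans (map_zero A).symm)))
    (fun v hv => by
      have h1 := hG.2.dist_le_mul v 0
      rw [dist_eq_norm, dist_eq_norm, hA, sub_zero] at h1
      exact h1.trans_lt (mul_lt_of_lt_one_left (norm_pos_iff.2 hv) (by exact_mod_cast hG.1)))
    (hev.mono fun t ht => by rw [← ht, ← hA, hGs])
    (fun m hm => by
      have h1 : AnalyticOnNhd ℝ (fun t => m (γ t)) (Ioo a b) := fun t ht =>
        (m.analyticAt _).comp (ha t ht)
      have h2 := h1.eqOn_of_preconnected_of_eventuallyEq analyticOnNhd_const isPreconnected_Ioo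
        hs hm
      have h3 := h2.of_subset_closure (m.continuous.comp_continuousOn hγ.continuousOn)
        continuousOn_const Ioo_subset_Icc_self (closure_Ioo hγ.lt.ne).ge
      refine eq_zero_of_forall_eq hnd m (m (γ s)) ?_
      rintro _ ⟨t, ht, rfl⟩
      exact h3 ht)
  exact ⟨s, m, D, w, hD, hw, eqOn_Icc_of_local_polynomial hγ.continuousOn ha hs hloc⟩

/-- An affine isomorphism turns the moment curve into the polynomial curve of degree `n` with
prescribed linearly independent coefficients. -/
lemma exists_affineEquiv_momentCurve_eq {n : ℕ} (z : EuclideanSpace ℝ (Fin n))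
    (w : ℕ → EuclideanSpace ℝ (Fin n))
    (hw : LinearIndependent ℝ fun k : Finset.Icc 1 n => w k) :
    ∃ f : EuclideanSpace ℝ (Fin n) ≃ᵃ[ℝ] EuclideanSpace ℝ (Fin n),
      ∀ x, f (momentCurve n x) = z + ∑ k ∈ Finset.Icc 1 n, x ^ k • w k := by
  have hw' : LinearIndependent ℝ fun i : Fin n => w ((i : ℕ) + 1) :=
    hw.comp (fun i : Fin n => ⟨(i : ℕ) + 1, Finset.mem_Icc.2 ⟨by omega, i.2⟩⟩) fun i j hij =>
      Fin.ext (Nat.succ.inj (Subtype.mk.inj hij))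
  let b := Module.Basis.mk hw' (hw'.span_eq_top_of_card_eq_finrank' (by simp)).ge
  refine ⟨((WithLp.linearEquiv 2 ℝ (Fin n → ℝ)).trans b.equivFun.symm).toAffineEquiv.trans
    (AffineEquiv.constVAdd ℝ _ z), fun x => ?_⟩
  rw [AffineEquiv.trans_apply, AffineEquiv.constVAdd_apply, vadd_eq_add]
  congr 1
  have h1 : ((WithLp.linearEquiv 2 ℝ (Fin n → ℝ)).trans b.equivFun.symm).toAffineEquiv
      (momentCurve n x) = b.equivFun.symm fun i => x ^ ((i : ℕ) + 1) := rfl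
  rw [h1, Module.Basis.equivFun_symm_apply]
  simp only [b, Module.Basis.mk_apply]
  rw [Fin.sum_univ_eq_sum_range (fun i => x ^ (i + 1) • w (i + 1)) n, Finset.range_eq_Ico,
    Finset.sum_Ico_add' (fun i => x ^ i • w i)]
  rfl

/-- The forward implication: the exponents of the polynomial curve are `1, …, n`, and a curve
with these exponents is an affine image of the moment curve. -/
lemma IsAnalyticCurve.exists_momentCurve_of_isNontrivialSelfAffine {n : ℕ} {a b : ℝ}
    {γ : ℝ → EuclideanSpace ℝ (Fin n)}
    (hγ : IsAnalyticCurve a b γ) (hnd : ¬ ∃ H, IsAffineHyperplane H ∧ γ '' Icc a b ⊆ H)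
    {E : Set (EuclideanSpace ℝ (Fin n))} (hE : IsNontrivialSelfAffine E)
    (hEγ : E ⊆ γ '' Icc a b) :
    ∃ (c d : ℝ) (f : EuclideanSpace ℝ (Fin n) ≃ᵃ[ℝ] EuclideanSpace ℝ (Fin n)),
      c < d ∧ γ '' Icc a b = (f ∘ momentCurve n) '' Icc c d := by
  obtain ⟨⟨hEne, hEc, l, f, hf, hEf⟩, hEs⟩ := hE
  obtain ⟨K, hK, hfK⟩ := exists_common_contractingWith hf
  have hmaps : ∀ i, MapsTo (f i) E E := fun i y hy => by
    rw [hEf]; exact mem_iUnion.2 ⟨i, mem_image_of_mem _ hy⟩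
  have hEinf : E.Infinite := by
    obtain ⟨x, hx⟩ := hEne
    have hx' := hx
    rw [hEf] at hx'
    obtain ⟨i, -⟩ := mem_iUnion.1 hx'
    have hc : ContractingWith K (f i) := ⟨hK, hfK i⟩
    obtain ⟨z, hzE, hz, -⟩ := hc.exists_fixedPoint_mem hEc.isClosed ⟨x, hx⟩ (hmaps i)
    obtain ⟨e, he, hez⟩ : ∃ e ∈ E, e ≠ z := by
      by_contra! h
      exact hEs ⟨z, Subset.antisymm h (singleton_subset_iff.2 hzE)⟩
    exact hc.infinite_of_mapsTo (f i).injective (hmaps i) hz he hez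
  obtain ⟨s, m, D, w, hD, hw, hΓ⟩ := hγ.exists_polynomial hnd hEγ hEc hEinf fun x hx U hU =>
    ⟨K, exists_small_copy hEc hEf hK hfK hx hU⟩
  set z := γ s with hz
  have hΓ' : ∀ y ∈ γ '' Icc a b, y = z + ∑ k ∈ D, (m (y - z)) ^ k • w k := by
    rintro _ ⟨t, ht, rfl⟩
    exact hΓ ht
  have hspan : Submodule.span ℝ (range fun k : D => w k) = ⊤ := by
    by_contra hne
    obtain ⟨μ, hμ, hle⟩ := Submodule.exists_le_ker_of_lt_top _ (lt_top_iff_ne_top.2 hne)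
    have h1 : LinearMap.toContinuousLinearMap μ = 0 := by
      refine eq_zero_of_forall_eq hnd _ (μ z) fun y hy => ?_
      rw [LinearMap.coe_toContinuousLinearMap', hΓ' y hy, map_add, map_sum,
        Finset.sum_eq_zero fun k hk => ?_, add_zero]
      have h2 : w k ∈ LinearMap.ker μ := hle (Submodule.subset_span ⟨⟨k, hk⟩, rfl⟩)
      rw [map_smul, LinearMap.mem_ker.1 h2, smul_zero]
    exact hμ ((LinearEquiv.map_eq_zero_iff _).1 h1)
  have hcard : D.card = n := by
    have := Module.finrank_eq_card_basis (Module.Basis.mk hw hspan.ge)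
    simpa using this.symm
  have hinj : InjOn (fun y => m (y - z)) E := fun y hy y' hy' h => by
    rw [hΓ' y (hEγ hy), hΓ' y' (hEγ hy')]
    simp only at h
    rw [h]
  have hDne : D.Nonempty := by
    by_contra h
    rw [Finset.not_nonempty_iff_eq_empty] at h
    refine hEinf ((Set.finite_singleton z).subset fun y hy => ?_)
    have := hΓ' y (hEγ hy)
    rwa [h, Finset.sum_empty, add_zero] at this
  obtain ⟨i, hi⟩ := exists_map_ne hEc hEf hK hfK hEinf z
  have hDI := Icc_subset_of_affine_maps_polynomial hD hDne (Module.Basis.mk hw hspan.ge)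
    (fun k => Module.Basis.mk_apply hw hspan.ge k) m (f i) (hEinf.image hinj) (by
      rintro _ ⟨y, hy, rfl⟩
      simp only
      rw [← hΓ' y (hEγ hy)]
      exact hΓ' _ (hEγ (hmaps i hy))) hi
  have hDn : D = Finset.Icc 1 n := by
    have h1 := congrArg Finset.card hDI
    rw [hcard, Nat.card_Icc, Nat.add_sub_cancel] at h1
    rwa [← h1] at hDI
  subst hDn
  obtain ⟨F, hF⟩ := exists_affineEquiv_momentCurve_eq z w hw
  have hγF : EqOn γ (fun t => F (momentCurve n (m (γ t - z)))) (Icc a b) := fun t ht => by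
    simp only
    rw [hF]
    exact hΓ ht
  have hcont : ContinuousOn (fun t => m (γ t - z)) (Icc a b) :=
    m.continuous.comp_continuousOn (hγ.continuousOn.sub continuousOn_const)
  obtain ⟨c, d, himg⟩ : ∃ c d, (fun t => m (γ t - z)) '' Icc a b = Icc c d :=
    ⟨_, _, hcont.image_Icc hγ.lt.le⟩
  refine ⟨c, d, F, ?_, ?_⟩
  · obtain ⟨t, ht, t', ht', hne⟩ := hγ.nonconstant
    by_contra hle
    have hsub := subsingleton_Icc_of_ge (not_lt.1 hle)
    rw [← himg] at hsub
    refine hne ?_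
    rw [hγF ht, hγF ht']
    exact congrArg (fun x => F (momentCurve n x))
      (hsub (mem_image_of_mem _ ht) (mem_image_of_mem _ ht'))
  · rw [← himg, image_image]
    exact hγF.image_eq

lemma isNontrivialSelfAffine_image_momentCurve {n : ℕ} (hn : n ≠ 0)
    (f : EuclideanSpace ℝ (Fin n) ≃ᵃ[ℝ] EuclideanSpace ℝ (Fin n)) {c d : ℝ} (hcd : c < d) :
    IsNontrivialSelfAffine ((f ∘ momentCurve n) '' Icc c d) := by
  refine ⟨isSelfAffine_image_momentCurve f hcd, ?_⟩
  rintro ⟨x, hx⟩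
  have hmem : ∀ t ∈ Icc c d, f (momentCurve n t) = x := fun t ht =>
    mem_singleton_iff.1 (hx ▸ mem_image_of_mem (f ∘ momentCurve n) ht)
  have h1 := f.injective ((hmem c (left_mem_Icc.2 hcd.le)).trans
    (hmem d (right_mem_Icc.2 hcd.le)).symm)
  have h2 := congrArg (fun v : EuclideanSpace ℝ (Fin n) => v ⟨0, Nat.pos_of_ne_zero hn⟩) h1
  simp only [momentCurve, zero_add, pow_one] at h2
  exact hcd.ne h2

theorem theoremA (n : ℕ) (hn : 2 ≤ n) :
    (∀ (a b : ℝ) (γ : ℝ → EuclideanSpace ℝ (Fin n)),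
      IsAnalyticCurve a b γ →
      (¬ ∃ H, IsAffineHyperplane H ∧ γ '' Set.Icc a b ⊆ H) →
      ((∃ E, IsNontrivialSelfAffine E ∧ E ⊆ γ '' Set.Icc a b) ↔
        ∃ (c d : ℝ) (f : EuclideanSpace ℝ (Fin n) ≃ᵃ[ℝ] EuclideanSpace ℝ (Fin n)),
          c < d ∧ γ '' Set.Icc a b = (f ∘ momentCurve n) '' Set.Icc c d)) ∧
    (∀ c d : ℝ, c < d → IsNontrivialSelfAffine (momentCurve n '' Set.Icc c d)) := by
  have hn0 : n ≠ 0 := by omega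
  refine ⟨fun a b γ hγ hnd => ⟨?_, ?_⟩, fun c d hcd => ?_⟩
  · rintro ⟨E, hE, hEγ⟩
    exact hγ.exists_momentCurve_of_isNontrivialSelfAffine hnd hE hEγ
  · rintro ⟨c, d, f, hcd, h⟩
    exact ⟨_, isNontrivialSelfAffine_image_momentCurve hn0 f hcd, h.ge⟩
  · exact isNontrivialSelfAffine_image_momentCurve hn0 (AffineEquiv.refl ℝ _) hcd
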